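/- **Notation.** Let $r\ge 2$. $\mathcal A_r$ is the real Cayley–Dickson algebra of dimension $2^r$ with unit $1$ and conjugation $z\mapsto\tilde z$, and $\mathcal A_{r,C}=\mathcal A_r\oplus{\bf i}\mathcal A_r$ is its complexification. On $\mathcal A_{r,C}^h$ put $\langle x,y\rangle=\sum_{l=1}^h x_l\tilde y_l$, where $\tilde z=z_0-z'$ for $z=z_0+z'$, $z_0\in\mathbb R$, ${\rm Re}\,z'=0$. $L_r(\mathcal A_{r,C}^n,\mathcal A_{r,C}^h)$ is the set of $\mathbb R$-linear operators $J:\mathcal A_{r,C}^n\to\mathcal A_{r,C}^h$ with $J(xb+yc)=(Jx)b+(Jy)c$ for all $x,y\in\mathbb R^n$, $b,c\in\mathcal A_{r,C}$; equivalently $Jx=\sum_{l,k}J_{l,k}x_kf_l$ with $J_{l,k}\in\mathcal A_{r,C}$, where $e_k$, $f_l$ are the standard bases of $\mathbb R^n$ and $\mathbb R^h$. $L_{r,i}$ is the set of those $J\in L_r$ with $J(\mathcal A_r^n)\subset\mathcal A_r^h$. The product $\{GH\}$ of two such operators is the element of $L_r$ that agrees with $G\circ H$ on real vectors (the product of the matrices),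 $Q^*$ is the conjugate transpose, that is, the element of $L_r$ with $\langle Qx,y\rangle=\langle x,Q^*y\rangle$ for real vectors $x,y$, and ${\rm Tr}\,Q=\sum_l\langle Qf_l,f_l\rangle$. **Setting.** Let $T=[0,s]$ with $0<s<\infty$, or $T=[0,\infty)$. Let $(\Omega,\mathcal F,{\sf P})$ be a probability space with a filtration $(\mathcal F_t)_{t\in T}$; $E$ denotes expectation with respect to ${\sf P}$. Let $U=\bigoplus_j a_jB_j\in L_{r,i}(\mathcal A_{r,C}^n,\mathcal A_{r,C}^n)$, where $a_j\in\mathcal A_r\setminus\{0\}$ and the $B_j$ are positive definite real matrices, and let $U^{1/2}=\bigoplus_j a_j^{1/2}B_j^{1/2}$, where $B_j^{1/2}$ is positive definite and $a_j^{1/2}\in\mathcal A_r$ is a square root of $a_j$, positive when $a_j>0$. Let $w$ be a $U$-random function in $\mathcal A_r^n$: for each $t\in T$, $w(t)=U^{1/2}\xi(t)$ ${\sf P}$-a.e., where $\xi$ is a standard Wiener process in $\mathbb R^n$ (zero mean, unit covariance operator; path continuity is not needed); $w(t)$ is $\mathcal F_t$-measurable, and $w(t)-w(u)$ is independent of $\mathcal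 F_u$ for $u<t$ in $T$. Let $S$ be an elementary $L_{r,i}(\mathcal A_{r,C}^n,\mathcal A_{r,C}^h)$-valued random function, $$S(t)=\sum_{l=0}^{k-1}S_l\,{\rm ch}_{(t_l,t_{l+1}]}(t),\qquad 0=t_0<t_1<\dots<t_k,\quad t_l\in T,$$ with $S_l$ being $\mathcal F_{t_l}$-measurable and $L_{r,i}$-valued. Put $\int_0^tS\,dw=\sum_{l}S_l\big(w(t_{l+1}\wedge t)-w(t_l\wedge t)\big)$ and $\int_a^tS\,dw=\int_0^tS\,dw-\int_0^aS\,dw$. **Theorem.** Let $a<t$ in $T$. Then $\langle\int_a^tS\,dw,\int_a^tS\,dw\rangle$ is ${\sf P}$-a.e. a non-negative real number, $\int_a^t{\rm Tr}(\{S(\tau)U^{1/2}\}\{(U^{1/2})^*S^*(\tau)\})\,d\tau$ is everywhere a non-negative real number, and $$E\Big[\Big\langle\int_a^tS\,dw,\int_a^tS\,dw\Big\rangle\Big|\mathcal F_a\Big]=E\Big[\int_a^t{\rm Tr}\big(\{S(\tau)U^{1/2}\}\{(U^{1/2})^*S^*(\tau)\}\big)\,d\tau\Big|\mathcal F_a\Big]\qquad{\sf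 P}\text{-a.e.},$$ as conditional expectations with values in $[0,\infty]$. One of the two random variables is integrable if and only if the other is, and then the equality holds for the usual conditional expectations of $\mathcal A_{r,C}$-valued integrable functions. If moreover $\langle\int_a^tS\,dw,\int_0^tS\,dw\rangle$ is integrable, then its conditional expectation given $\mathcal F_a$ equals the same right-hand side ${\sf P}$-a.e. -/

import Mathlib

open MeasureTheory ProbabilityTheory Filter
open scoped ENNReal

noncomputable section

/-- The complexified Cayley-Dickson algebra `A_{r,C} = A_r ⊕ 𝐢 A_r`, as the complex vector space
on the `2 ^ r` standard generators `i_s`. A generator is labelled by a bit string `s` of length `r`,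
the zero string being the unit `i_0 = 1`; the central imaginary unit `𝐢` is the scalar
`Complex.I`. -/
def CDC (r : ℕ) : Type := EuclideanSpace ℂ (Fin r → Bool)

namespace CDC

instance (r : ℕ) : NormedAddCommGroup (CDC r) :=
  inferInstanceAs (NormedAddCommGroup (EuclideanSpace ℂ (Fin r → Bool)))

instance (r : ℕ) : NormedSpace ℂ (CDC r) :=
  inferInstanceAs (NormedSpace ℂ (EuclideanSpace ℂ (Fin r → Bool)))

instance (r : ℕ) : FiniteDimensional ℂ (CDC r) :=
  inferInstanceAs (FiniteDimensional ℂ (EuclideanSpace ℂ (Fin r → Bool)))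

instance (r : ℕ) : FiniteDimensional ℝ (CDC r) := FiniteDimensional.complexToReal (CDC r)

instance (r : ℕ) : CompleteSpace (CDC r) :=
  inferInstanceAs (CompleteSpace (EuclideanSpace ℂ (Fin r → Bool)))

instance (r : ℕ) : MeasurableSpace (CDC r) := borel (CDC r)

instance (r : ℕ) : BorelSpace (CDC r) := ⟨rfl⟩

variable {r : ℕ}

/-- The coefficient of `z` at the generator `i_s`. -/
def coord (z : CDC r) (s : Fin r → Bool) : ℂ := WithLp.ofLp (p := 2) (V := (Fin r → Bool) → ℂ) z s

/-- The element with prescribed coefficients. -/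
def mk (f : (Fin r → Bool) → ℂ) : CDC r := WithLp.toLp 2 f

@[simp] theorem coord_mk (f : (Fin r → Bool) → ℂ) (s : Fin r → Bool) : (mk f).coord s = f s := rfl

@[ext] theorem ext {x y : CDC r} (h : ∀ s, x.coord s = y.coord s) : x = y :=
  (WithLp.equiv 2 ((Fin r → Bool) → ℂ)).injective (funext h)

@[simp] theorem coord_add (x y : CDC r) (s : Fin r → Bool) :
    (x + y).coord s = x.coord s + y.coord s := rfl

@[simp] theorem coord_sub (x y : CDC r) (s : Fin r → Bool) :
    (x - y).coord s = x.coord s - y.coord s := rfl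

@[simp] theorem coord_smul (c : ℂ) (x : CDC r) (s : Fin r → Bool) :
    (c • x).coord s = c * x.coord s := rfl

/-- The unit `i_0`. -/
instance : One (CDC r) := ⟨mk fun s => if s = (fun _ => false) then 1 else 0⟩

/-- The `ℂ`-linear extension to `A_{r,C}` of the conjugation of `A_r`. -/
def conj (z : CDC r) : CDC r :=
  mk fun s => if s = (fun _ => false) then z.coord s else -z.coord s

/-- `z̃ = z₀ - z'` for `z = z₀ + z'` with `z₀` real and `Re z' = 0`. On `A_r` this is the usual
conjugation. -/
def tilde (z : CDC r) : CDC r :=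
  mk fun s => if s = (fun _ => false) then star (z.coord s) else -z.coord s

/-- The real part of `z`, the real part of its coefficient at `1`. -/
def re (z : CDC r) : ℝ := (z.coord fun _ => false).re

/-- The component `a` of `z = a + b l` in the doubling `A_{r+1} = A_r ⊕ A_r l`. -/
def fstHalf (z : CDC (r + 1)) : CDC r := mk fun s => z.coord (Fin.cons false s)

/-- The component `b` of `z = a + b l` in the doubling `A_{r+1} = A_r ⊕ A_r l`. -/
def sndHalf (z : CDC (r + 1)) : CDC r := mk fun s => z.coord (Fin.cons true s)

/-- The element `a + b l`. -/
def double (a b : CDC r) : CDC (r + 1) :=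
  mk fun s => if s 0 then b.coord (Fin.tail s) else a.coord (Fin.tail s)

/-- The Cayley-Dickson product, by the doubling formula
`(a + b l) (c + d l) = (a c - d̃ b) + (d a + b c̃) l`, extended `ℂ`-bilinearly. -/
def mulAux : (r : ℕ) → CDC r → CDC r → CDC r
  | 0, x, y => mk fun s => x.coord s * y.coord s
  | r + 1, x, y =>
    double
      (mulAux r x.fstHalf y.fstHalf - mulAux r y.sndHalf.conj x.sndHalf)
      (mulAux r y.sndHalf x.fstHalf + mulAux r x.sndHalf y.fstHalf.conj)

instance : Mul (CDC r) := ⟨mulAux r⟩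

/-- The Cayley-Dickson algebra `A_r` inside `A_{r,C}`: all coefficients are real. -/
def realForm (r : ℕ) : Set (CDC r) := {z | ∀ s, (z.coord s).im = 0}

/-- The product is additive in each argument. -/
theorem mulAux_add : ∀ (r : ℕ) (x y z : CDC r),
    mulAux r x (y + z) = mulAux r x y + mulAux r x z ∧
      mulAux r (x + y) z = mulAux r x z + mulAux r y z
  | 0, x, y, z => by
    constructor <;> ext s <;> simp [mulAux] <;> ring
  | r + 1, x, y, z => by
    have hf : ∀ u v : CDC (r + 1), (u + v).fstHalf = u.fstHalf + v.fstHalf := fun _ _ => rfl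
    have hs : ∀ u v : CDC (r + 1), (u + v).sndHalf = u.sndHalf + v.sndHalf := fun _ _ => rfl
    have hc : ∀ u v : CDC r, (u + v).conj = u.conj + v.conj := by
      intro u v
      ext s
      by_cases h : s = (fun _ => false) <;> simp [conj, h] <;> ring
    constructor <;> ext s <;> cases h : s 0 <;>
      simp [mulAux, double, h, hf, hs, hc, (mulAux_add r _ _ _).1, (mulAux_add r _ _ _).2] <;> ring

/-- The product is `ℂ`-homogeneous in each argument. -/
theorem mulAux_smul : ∀ (r : ℕ) (c : ℂ) (x y : CDC r),
    mulAux r x (c • y) = c • mulAux r x y ∧ mulAux r (c • x) y = c • mulAux r x y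
  | 0, c, x, y => by
    constructor <;> ext s <;> simp [mulAux] <;> ring
  | r + 1, c, x, y => by
    have hf : ∀ u : CDC (r + 1), (c • u).fstHalf = c • u.fstHalf := fun _ => rfl
    have hs : ∀ u : CDC (r + 1), (c • u).sndHalf = c • u.sndHalf := fun _ => rfl
    have hc : ∀ u : CDC r, (c • u).conj = c • u.conj := by
      intro u
      ext s
      by_cases h : s = (fun _ => false) <;> simp [conj, h]
    constructor <;> ext s <;> cases h : s 0 <;>
      simp [mulAux, double, h, hf, hs, hc, (mulAux_smul r _ _ _).1, (mulAux_smul r _ _ _).2] <;>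
      ring

theorem mul_add' (x y z : CDC r) : x * (y + z) = x * y + x * z := (mulAux_add r x y z).1

theorem mul_smul' (c : ℂ) (x y : CDC r) : x * (c • y) = c • (x * y) := (mulAux_smul r c x y).1

end CDC

/-- The `ℝ`-linear operators from `A_{r,C}^n` to `A_{r,C}^h`. They are all continuous, and the space
of operators carries the Borel σ-algebra of the operator norm. -/
abbrev CDOp (r n h : ℕ) : Type := (Fin n → CDC r) →L[ℝ] (Fin h → CDC r)

namespace CDOp

variable {r n m h : ℕ}

/-- The embedding of `ℝ^n` into `A_{r,C}^n` as `i_0 ℝ^n`. -/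
def ofReal (x : Fin n → ℝ) : Fin n → CDC r := fun k => x k • (1 : CDC r)

/-- The standard basis vector `e_k`. -/
def e (k : Fin n) : Fin n → CDC r := ofReal (Pi.single k 1)

/-- `L_r(A_{r,C}^n, A_{r,C}^h)`: the operators that are right `A_{r,C}`-linear in the weak sense,
`J (x b + y c) = (J x) b + (J y) c` for `x`, `y` in `ℝ^n` and `b`, `c` in `A_{r,C}`. -/
def Lr (r n h : ℕ) : Set (CDOp r n h) :=
  {J | ∀ (x y : Fin n → ℝ) (b c : CDC r),
    J (fun k => ofReal x k * b + ofReal y k * c) =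
      fun l => J (ofReal x) l * b + J (ofReal y) l * c}

/-- `L_{r,i}(A_{r,C}^n, A_{r,C}^h)`: the members of `L_r` that map `A_r^n` into `A_r^h`. -/
def Lri (r n h : ℕ) : Set (CDOp r n h) :=
  {J | J ∈ Lr r n h ∧
    ∀ x : Fin n → CDC r, (∀ k, x k ∈ CDC.realForm r) → ∀ l, J x l ∈ CDC.realForm r}

/-- The operator `x ↦ (∑_k M_{l,k} x_k)_l` given by a matrix over `A_{r,C}`. Each member of `L_r` is
of this form, `M_{l,k}` being the `l`-th component of its value at `e_k`. -/
def ofMatrix (M : Matrix (Fin h) (Fin n) (CDC r)) : CDOp r n h :=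
  LinearMap.toContinuousLinearMap
    { toFun := fun x l => ∑ k, M l k * x k
      map_add' := by
        intro x y
        funext l
        simp [CDC.mul_add', Finset.sum_add_distrib]
      map_smul' := by
        intro c x
        funext l
        simp only [Pi.smul_apply, RingHom.id_apply, Finset.smul_sum]
        refine Finset.sum_congr rfl fun k _ => ?_
        exact CDC.mul_smul' (c : ℂ) _ _ }

/-- The product `{G H}` of two operators of `L_r`: the operator of `L_r` that agrees with the
composition `G ∘ H` on `ℝ^m`. (For a non-associative algebra the composition itself need not be
right linear.) Its matrix is the product of the matrices of `G` and `H`. -/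
def prod (G : CDOp r n h) (H : CDOp r m n) : CDOp r m h :=
  ofMatrix fun l k => G (H (e k)) l

/-- The form `⟨x, y⟩ = x_1 ỹ_1 + ... + x_h ỹ_h`. -/
def form (x y : Fin h → CDC r) : CDC r := ∑ l, x l * (y l).tilde

/-- The adjoint `Q*` of an operator of `L_r`, its conjugate transpose: the operator of `L_r` with
`⟨Q x, y⟩ = ⟨x, Q* y⟩` for `x`, `y` with real coordinates. -/
def adj (Q : CDOp r n h) : CDOp r h n :=
  ofMatrix fun k l => (Q (e k) l).tilde

/-- The trace `∑_l ⟨Q e_l, e_l⟩`. -/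
def tr (Q : CDOp r n n) : CDC r := ∑ l, form (Q (e l)) (e l)

/-- The matrix over `A_{r,C}` of the direct sum `⊕_j a_j B_j` of multiples of real square
matrices, the coordinates being distributed over the blocks by `σ`. -/
def blockSum {p : ℕ} {d : Fin p → ℕ} (σ : Fin n ≃ Σ j, Fin (d j)) (a : Fin p → CDC r)
    (B : ∀ j, Matrix (Fin (d j)) (Fin (d j)) ℝ) : Matrix (Fin n) (Fin n) (CDC r) :=
  fun k l => Matrix.blockDiagonal' (fun j => (B j).map fun b => b • a j) (σ k) (σ l)

/-- `V` is a square root `U^{1/2} = ⊕_j a_j^{1/2} B_j^{1/2}` of an operator `U = ⊕_j a_j B_j`, where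
`a_j` is a non-zero element of `A_r`, `B_j` is a positive definite real matrix, `B_j^{1/2}` is its
positive definite square root and `a_j^{1/2}` is a square root of `a_j` in `A_r` that is
positive if `a_j` is. -/
def IsSqrt (U V : CDOp r n n) : Prop :=
  ∃ (p : ℕ) (d : Fin p → ℕ) (σ : Fin n ≃ Σ j, Fin (d j)) (a c : Fin p → CDC r)
    (B C : ∀ j, Matrix (Fin (d j)) (Fin (d j)) ℝ),
    (∀ j, a j ∈ CDC.realForm r ∧ a j ≠ 0) ∧
    (∀ j, c j ∈ CDC.realForm r ∧ c j * c j = a j) ∧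
    (∀ j (x : ℝ), 0 < x → a j = x • (1 : CDC r) → c j = Real.sqrt x • (1 : CDC r)) ∧
    (∀ j, (B j).PosDef ∧ (C j).PosDef ∧ C j * C j = B j) ∧
    U = ofMatrix (blockSum σ a B) ∧ V = ofMatrix (blockSum σ c C)

end CDOp

section Stochastics

variable {Ω : Type*} {mΩ : MeasurableSpace Ω} {T : Set ℝ} {r n h : ℕ}

/-- `ξ` is a standard Wiener process in `ℝ^n` on the time set `T`, with zero mean and unit
covariance operator: it starts at `0`, its increments are independent, and `ξ t - ξ u` has law
`N(0, (t - u) I)`. Continuity of the paths is not asked for. -/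
structure IsStdWiener (P : Measure Ω) (ξ : T → Ω → (Fin n → ℝ)) : Prop where
  aemeasurable : ∀ t, AEMeasurable (ξ t) P
  zero : ∀ t : T, (t : ℝ) = 0 → ∀ᵐ ω ∂P, ξ t ω = 0
  indep : HasIndepIncrements ξ P
  law : ∀ u t : T, u ≤ t → P.map (fun ω => ξ t ω - ξ u ω) =
    Measure.pi fun _ => gaussianReal 0 (Real.toNNReal ((t : ℝ) - (u : ℝ)))

/-- `w` is a `U`-random function with respect to the filtration `F` and the probability `P`, where
`V = U^{1/2}`: it is obtained as `w = U^{1/2} ξ`, almost surely at each time, from a standard Wiener process `ξ` in `ℝ^n`, it is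
adapted to `F`, and its increments after time `u` are independent of `F u`. -/
structure IsURandom (P : Measure Ω) (F : Filtration T mΩ) (V : CDOp r n n)
    (w : T → Ω → (Fin n → CDC r)) : Prop where
  wiener : ∃ ξ : T → Ω → (Fin n → ℝ), IsStdWiener P ξ ∧
    ∀ t, ∀ᵐ ω ∂P, w t ω = V (CDOp.ofReal (ξ t ω))
  adapted : ∀ t, Measurable[F t] (w t)
  indep : ∀ u t : T, u < t →
    Indep (MeasurableSpace.comap (fun ω => w t ω - w u ω) inferInstance) (F u) P

/-- An elementary random function with values in `L_{r,i}(A_{r,C}^n, A_{r,C}^h)`: a partition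
`0 = t_0 < ... < t_k` and an `F_{t_l}`-measurable random operator `S_l` for each `l < k`. -/
structure ElementaryProcess (F : Filtration T mΩ) (r n h : ℕ) where
  k : ℕ
  pt : Fin (k + 1) → T
  pt_strictMono : StrictMono pt
  pt_zero : (pt 0 : ℝ) = 0
  coef : Fin k → Ω → CDOp r n h
  measurable_coef : ∀ l, Measurable[F (pt l.castSucc)] (coef l)
  coef_mem : ∀ l ω, coef l ω ∈ CDOp.Lri r n h

namespace ElementaryProcess

variable {F : Filtration T mΩ}

/-- `S(τ) = ∑_l S_l ch_{(t_l, t_{l+1}]}(τ)`. -/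
def value (S : ElementaryProcess F r n h) (τ : ℝ) (ω : Ω) : CDOp r n h :=
  ∑ l, Set.indicator (Set.Ioc (S.pt l.castSucc : ℝ) (S.pt l.succ : ℝ)) (fun _ => S.coef l ω) τ

/-- `∫_0^t S dw = ∑_l S_l (w(t_{l+1} ∧ t) - w(t_l ∧ t))`. -/
def integralTo (S : ElementaryProcess F r n h) (w : T → Ω → (Fin n → CDC r)) (t : T) (ω : Ω) :
    Fin h → CDC r :=
  ∑ l, S.coef l ω (w (min (S.pt l.succ) t) ω - w (min (S.pt l.castSucc) t) ω)

/-- `∫_a^t S dw = ∫_0^t S dw - ∫_0^a S dw`. -/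
def integral (S : ElementaryProcess F r n h) (w : T → Ω → (Fin n → CDC r)) (a t : T) (ω : Ω) :
    Fin h → CDC r :=
  S.integralTo w t ω - S.integralTo w a ω

/-- `∫_a^t Tr ({S(τ) V} {V* S(τ)*}) dτ`. -/
def traceIntegral (S : ElementaryProcess F r n h) (V : CDOp r n n) (a t : T) (ω : Ω) : CDC r :=
  ∫ τ in (a : ℝ)..(t : ℝ),
    CDOp.tr (CDOp.prod (CDOp.prod (S.value τ ω) V) (CDOp.prod V.adj (S.value τ ω).adj))

end ElementaryProcess

end Stochastics

end

/-! On `A_r` one has `x x̃ = |x|² 1`, so both sides of the identity are real multiples of the unit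
and the theorem reduces to a statement about non-negative reals. Write `V = U^{1/2}`. The matrix
entries of `V` lie in `A_r`, hence so do the components of `∫ S dw`, almost surely, and the form of
the integral with itself is `normSq` times `1` (`form_self`). Conjugation reverses products, so the
entries of `{V* S*}` are the conjugates of those of `{S V}`. The trace is therefore `∑_k |S V
e_k|²`, called `weight V S` (`tr_prod_adj`). Associativity is never needed: only products of two
factors occur.

What remains is the Itô isometry over each set `A` of `F a`, in `[0, ∞]`. Over one interval `(u,
t]`, freeze the `F u`-measurable data: the integral `X` so far and the coefficient `S`. The
increment of `w` is independent of `F u` and distributed as `V δ` with `δ` of law `N(0, (t - u) I)`.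
Its mean is zero, so the cross term drops out of the Gaussian integral and `E |x + S V δ|² = |x|² +
(t - u) weight V S` (`lintegral_normSq_add_pi_gaussianReal`). Everything is non-negative, so
Tonelli's theorem suffices and no moment of `S` is assumed (`setLIntegral_normSq_add`). Induction
over the partition of `[a, t]` adds up the steps (`setLIntegral_normSq_sum`). Equality of the
integrals over all `A` in `F a` gives both kinds of conditional expectation and the equivalence of
integrability.

For the last claim, `∫_0^t = ∫_a^t + ∫_0^a`. The second part is `F a`-measurable and can be pulled
out of the conditional expectation, where it meets `E[∫_a^t S dw | F a] = 0`
(`condExp_sum_eq_zero`). -/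

noncomputable section

/-! ### Cayley-Dickson algebra: unit, conjugation and norm -/

namespace CDC

variable {r : ℕ}

@[simp] theorem coord_zero (s : Fin r → Bool) : (0 : CDC r).coord s = 0 := rfl

@[simp] theorem coord_neg (x : CDC r) (s : Fin r → Bool) : (-x).coord s = -x.coord s := rfl

@[simp] theorem coord_real_smul (c : ℝ) (x : CDC r) (s : Fin r → Bool) :
    (c • x).coord s = c * x.coord s := rfl

theorem coord_one (s : Fin r → Bool) :
    (1 : CDC r).coord s = if s = (fun _ => false) then 1 else 0 := rfl

theorem coord_conj (z : CDC r) (s : Fin r → Bool) :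
    z.conj.coord s = if s = (fun _ => false) then z.coord s else -z.coord s := rfl

theorem coord_tilde (z : CDC r) (s : Fin r → Bool) :
    z.tilde.coord s = if s = (fun _ => false) then star (z.coord s) else -z.coord s := rfl

@[simp] theorem coord_sum {ι : Type*} (t : Finset ι) (f : ι → CDC r) (s : Fin r → Bool) :
    (∑ i ∈ t, f i).coord s = ∑ i ∈ t, (f i).coord s := by
  classical
  induction t using Finset.induction_on with
  | empty => simp
  | insert a t ha ih => simp [Finset.sum_insert ha, ih]

theorem mul_def (x y : CDC r) : x * y = mulAux r x y := rfl

theorem add_mul' (x y z : CDC r) : (x + y) * z = x * z + y * z := (mulAux_add r x y z).2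

theorem smul_mul' (c : ℂ) (x y : CDC r) : (c • x) * y = c • (x * y) := (mulAux_smul r c x y).2

theorem mul_real_smul (c : ℝ) (x y : CDC r) : x * (c • y) = c • (x * y) :=
  mul_smul' (c : ℂ) x y

theorem real_smul_mul (c : ℝ) (x y : CDC r) : (c • x) * y = c • (x * y) :=
  smul_mul' (c : ℂ) x y

/-- Multiplication as a real-bilinear map. -/
def mulLin (r : ℕ) : CDC r →ₗ[ℝ] CDC r →ₗ[ℝ] CDC r :=
  LinearMap.mk₂ ℝ (fun x y => x * y) add_mul' real_smul_mul mul_add' mul_real_smul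

theorem zero_mul' (x : CDC r) : 0 * x = 0 := map_zero ((mulLin r).flip x)

theorem mul_zero' (x : CDC r) : x * 0 = 0 := map_zero (mulLin r x)

theorem neg_mul' (x y : CDC r) : -x * y = -(x * y) := map_neg ((mulLin r).flip y) x

theorem mul_neg' (x y : CDC r) : x * -y = -(x * y) := map_neg (mulLin r x) y

section Doubling

theorem cons_eq_zero_iff (b : Bool) (s : Fin r → Bool) :
    (Fin.cons b s : Fin (r + 1) → Bool) = (fun _ => false) ↔ b = false ∧ s = fun _ => false := by
  constructor
  · intro h
    exact ⟨by simpa using congrFun h 0, funext fun i => by simpa using congrFun h i.succ⟩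
  · rintro ⟨rfl, rfl⟩
    funext i
    refine Fin.cases ?_ (fun i => ?_) i <;> simp

theorem ext_half {x y : CDC (r + 1)} (hf : x.fstHalf = y.fstHalf) (hs : x.sndHalf = y.sndHalf) :
    x = y := by
  ext s
  rw [← Fin.cons_self_tail s]
  cases s 0
  · exact congrArg (fun z => z.coord (Fin.tail s)) hf
  · exact congrArg (fun z => z.coord (Fin.tail s)) hs

@[simp] theorem fstHalf_double (a b : CDC r) : (double a b).fstHalf = a := by
  ext s; simp [fstHalf, double]

@[simp] theorem sndHalf_double (a b : CDC r) : (double a b).sndHalf = b := by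
  ext s; simp [sndHalf, double]

theorem fstHalf_mul (x y : CDC (r + 1)) :
    (x * y).fstHalf = x.fstHalf * y.fstHalf - y.sndHalf.conj * x.sndHalf :=
  fstHalf_double _ _

theorem sndHalf_mul (x y : CDC (r + 1)) :
    (x * y).sndHalf = y.sndHalf * x.fstHalf + x.sndHalf * y.fstHalf.conj :=
  sndHalf_double _ _

theorem fstHalf_smul (c : ℂ) (x : CDC (r + 1)) : (c • x).fstHalf = c • x.fstHalf := rfl

theorem sndHalf_smul (c : ℂ) (x : CDC (r + 1)) : (c • x).sndHalf = c • x.sndHalf := rfl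

theorem fstHalf_conj (x : CDC (r + 1)) : x.conj.fstHalf = x.fstHalf.conj := by
  ext s; simp [fstHalf, coord_conj, cons_eq_zero_iff]

theorem sndHalf_conj (x : CDC (r + 1)) : x.conj.sndHalf = -x.sndHalf := by
  ext s; simp [sndHalf, coord_conj, cons_eq_zero_iff]

theorem fstHalf_one : (1 : CDC (r + 1)).fstHalf = 1 := by
  ext s; simp [fstHalf, coord_one, cons_eq_zero_iff]

theorem sndHalf_one : (1 : CDC (r + 1)).sndHalf = 0 := by
  ext s; simp [sndHalf, coord_one, cons_eq_zero_iff]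

end Doubling

@[simp] theorem conj_conj (x : CDC r) : x.conj.conj = x := by
  ext s; by_cases h : s = (fun _ => false) <;> simp [coord_conj, h]

theorem conj_neg (x : CDC r) : (-x).conj = -x.conj := by
  ext s; by_cases h : s = (fun _ => false) <;> simp [coord_conj, h]

theorem conj_sub (x y : CDC r) : (x - y).conj = x.conj - y.conj := by
  ext s; by_cases h : s = (fun _ => false) <;> simp [coord_conj, h]; ring

@[simp] theorem conj_zero : (0 : CDC r).conj = 0 := by
  ext s; simp [coord_conj]

@[simp] theorem conj_one : (1 : CDC r).conj = 1 := by
  ext s; by_cases h : s = (fun _ => false) <;> simp [coord_conj, coord_one, h]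

theorem one_mul_and_mul_one : ∀ (r : ℕ) (x : CDC r), 1 * x = x ∧ x * 1 = x
  | 0, x => by
    constructor <;> ext s <;>
      simp [mul_def, mulAux, coord_one, Subsingleton.elim s (fun _ => false)]
  | r + 1, x => by
    constructor <;> refine ext_half ?_ ?_ <;>
      simp [fstHalf_mul, sndHalf_mul, fstHalf_one, sndHalf_one, one_mul_and_mul_one r, mul_zero',
        zero_mul']

theorem one_mul' (x : CDC r) : 1 * x = x := (one_mul_and_mul_one r x).1

theorem mul_one' (x : CDC r) : x * 1 = x := (one_mul_and_mul_one r x).2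

/-- Induction on the doubling: conjugation sends `(a, b)` to `(ã, -b)`, and the doubling formula is
symmetric enough to carry the reversal from one level to the next. -/
theorem conj_mul : ∀ {r : ℕ} (x y : CDC r), (x * y).conj = y.conj * x.conj
  | 0, x, y => by
    ext s
    simp [mul_def, mulAux, coord_conj, Subsingleton.elim s (fun _ => false), mul_comm]
  | r + 1, x, y => by
    refine ext_half ?_ ?_ <;>
      simp [fstHalf_mul, sndHalf_mul, fstHalf_conj, sndHalf_conj, conj_mul (r := r), conj_sub,
        conj_neg, mul_neg', neg_mul', add_comm]

/-- The sum of the squares of the coefficients is the quadratic form `x x̃` of the complexified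
algebra. -/
theorem mul_conj_self : ∀ {r : ℕ} (x : CDC r), x * x.conj = (∑ s, x.coord s ^ 2) • (1 : CDC r)
  | 0, x => by
    ext s
    obtain rfl := Subsingleton.elim (default : Fin 0 → Bool) s
    simp [mul_def, mulAux, coord_conj, coord_one, Subsingleton.elim default (fun _ => false), sq]
  | r + 1, x => by
    -- The first half of `x x̃` is `a ã + b̃ b`, so the induction hypothesis is needed at `b̃`
    -- rather than `b`. Conjugation changes only signs, which the squares do not see.
    have hsum : ∑ s, x.coord s ^ 2 =
        ∑ s, x.fstHalf.coord s ^ 2 + ∑ s, x.sndHalf.conj.coord s ^ 2 := by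
      rw [← (Fin.consEquiv fun _ : Fin (r + 1) => Bool).sum_comp, Fintype.sum_prod_type,
        Fintype.sum_bool, add_comm]
      congr 1
      refine Finset.sum_congr rfl fun s _ => ?_
      by_cases h : s = (fun _ => false) <;> simp [coord_conj, h, sndHalf, Fin.consEquiv]
    have h1 : ∀ c : ℂ, (c • (1 : CDC (r + 1))).fstHalf = c • (1 : CDC r) := fun c => by
      rw [fstHalf_smul, fstHalf_one]
    have h2 : ∀ c : ℂ, (c • (1 : CDC (r + 1))).sndHalf = 0 := fun c => by
      rw [sndHalf_smul, sndHalf_one, smul_zero]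
    refine ext_half ?_ ?_
    · have := mul_conj_self x.sndHalf.conj
      rw [conj_conj] at this
      rw [h1, hsum, add_smul, fstHalf_mul, fstHalf_conj, sndHalf_conj, conj_neg, neg_mul',
        sub_neg_eq_add, mul_conj_self x.fstHalf, this]
    · simp [sndHalf_mul, fstHalf_conj, sndHalf_conj, neg_mul', h2]

theorem norm_sq (x : CDC r) : ‖x‖ ^ 2 = ∑ s, ‖x.coord s‖ ^ 2 :=
  EuclideanSpace.norm_sq_eq (𝕜 := ℂ) (n := Fin r → Bool) x

/-- `A_r` as a real subspace of `A_{r,C}`. -/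
def realSub (r : ℕ) : Submodule ℝ (CDC r) where
  carrier := realForm r
  add_mem' := fun {x y} hx hy s => by simp [hx s, hy s]
  zero_mem' := fun s => by simp
  smul_mem' := fun c x hx s => by simp [hx s]

theorem one_mem_realForm : (1 : CDC r) ∈ realForm r := fun s => by
  rw [coord_one]; split_ifs <;> simp

theorem conj_mem_realForm {x : CDC r} (hx : x ∈ realForm r) : x.conj ∈ realForm r := fun s => by
  rw [coord_conj]; split_ifs <;> simp [hx s]

theorem mul_mem_realForm : ∀ {r : ℕ} {x y : CDC r}, x ∈ realForm r → y ∈ realForm r →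
    x * y ∈ realForm r
  | 0, x, y, hx, hy => fun s => by simp [mul_def, mulAux, hx s, hy s]
  | r + 1, x, y, hx, hy => by
    have h1 : ∀ {z : CDC (r + 1)}, z ∈ realForm (r + 1) → z.fstHalf ∈ realForm r :=
      fun hz s => hz _
    have h2 : ∀ {z : CDC (r + 1)}, z ∈ realForm (r + 1) → z.sndHalf ∈ realForm r :=
      fun hz s => hz _
    have hf : (x * y).fstHalf ∈ realSub r := by
      rw [fstHalf_mul]
      exact sub_mem (mul_mem_realForm (h1 hx) (h1 hy))
        (mul_mem_realForm (conj_mem_realForm (h2 hy)) (h2 hx))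
    have hs : (x * y).sndHalf ∈ realSub r := by
      rw [sndHalf_mul]
      exact add_mem (mul_mem_realForm (h2 hy) (h1 hx))
        (mul_mem_realForm (h2 hx) (conj_mem_realForm (h1 hy)))
    intro s
    rw [← Fin.cons_self_tail s]
    cases s 0
    · exact hf _
    · exact hs _

theorem tilde_eq_conj {x : CDC r} (hx : x ∈ realForm r) : x.tilde = x.conj := by
  ext s
  have : star (x.coord s) = x.coord s := Complex.conj_eq_iff_im.2 (hx s)
  rw [coord_tilde, coord_conj, this]

theorem tilde_add (x y : CDC r) : (x + y).tilde = x.tilde + y.tilde := by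
  ext s; by_cases h : s = (fun _ => false) <;> simp [coord_tilde, h]; ring

theorem tilde_real_smul (c : ℝ) (x : CDC r) : (c • x).tilde = c • x.tilde := by
  ext s; by_cases h : s = (fun _ => false) <;> simp [coord_tilde, h]

theorem tilde_one : (1 : CDC r).tilde = 1 := by
  rw [tilde_eq_conj one_mem_realForm, conj_one]

theorem tilde_zero : (0 : CDC r).tilde = 0 := by
  ext s; simp [coord_tilde]

theorem tilde_sum {ι : Type*} (t : Finset ι) (f : ι → CDC r) :
    (∑ i ∈ t, f i).tilde = ∑ i ∈ t, (f i).tilde :=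
  map_sum (⟨⟨tilde, tilde_add⟩, tilde_real_smul⟩ : CDC r →ₗ[ℝ] CDC r) f t

theorem tilde_mul {x y : CDC r} (hx : x ∈ realForm r) (hy : y ∈ realForm r) :
    (x * y).tilde = y.tilde * x.tilde := by
  rw [tilde_eq_conj hx, tilde_eq_conj hy, tilde_eq_conj (mul_mem_realForm hx hy), conj_mul]

theorem mul_tilde_self {x : CDC r} (hx : x ∈ realForm r) : x * x.tilde = ‖x‖ ^ 2 • (1 : CDC r) := by
  -- For real coefficients the complex quadratic form and the Hermitian norm coincide; off `A_r`
  -- they differ.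
  have : ((∑ s, x.coord s ^ 2 : ℂ)) = ((‖x‖ ^ 2 : ℝ) : ℂ) := by
    rw [norm_sq]
    push_cast
    refine Finset.sum_congr rfl fun s _ => ?_
    rw [← Complex.conj_mul', Complex.conj_eq_iff_im.2 (hx s), sq]
  rw [tilde_eq_conj hx, mul_conj_self, this]
  rfl

@[simp] theorem re_real_smul_one (x : ℝ) : (x • (1 : CDC r)).re = x := by
  simp [re, coord_one]

theorem norm_one : ‖(1 : CDC r)‖ = 1 := by
  refine (pow_eq_one_iff_of_nonneg (_root_.norm_nonneg _) two_ne_zero).1 ?_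
  rw [norm_sq, Finset.sum_eq_single (fun _ => false) (fun s _ hs => by simp [coord_one, hs])
    (by simp)]
  simp [coord_one]

end CDC

/-! ### Operators, adjoints and the trace -/

namespace CDOp

variable {r n m h : ℕ}

open CDC

/-- The sum of the squared norms of the components. -/
def normSq (x : Fin h → CDC r) : ℝ := ∑ l, ‖x l‖ ^ 2

theorem normSq_nonneg (x : Fin h → CDC r) : 0 ≤ normSq x :=
  Finset.sum_nonneg fun _ _ => by positivity

theorem form_self {x : Fin h → CDC r} (hx : ∀ l, x l ∈ realForm r) :
    form x x = normSq x • (1 : CDC r) := by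
  simp only [form, normSq, Finset.sum_smul, mul_tilde_self (hx _)]

@[simp] theorem e_apply (k l : Fin n) : (e k : Fin n → CDC r) l = if l = k then 1 else 0 := by
  by_cases hlk : l = k
  · subst hlk; simp [e, ofReal]
  · simp [e, ofReal, hlk]

@[simp] theorem ofMatrix_apply (M : Matrix (Fin h) (Fin n) (CDC r)) (x : Fin n → CDC r)
    (l : Fin h) : ofMatrix M x l = ∑ k, M l k * x k := rfl

theorem ofMatrix_e (M : Matrix (Fin h) (Fin n) (CDC r)) (k : Fin n) (l : Fin h) :
    ofMatrix M (e k) l = M l k := by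
  rw [ofMatrix_apply, Finset.sum_eq_single k (fun j _ hj => by simp [hj, mul_zero'])
    (by simp)]
  simp [mul_one']

theorem eq_sum_e_mul (x : Fin n → CDC r) : x = ∑ k, fun l => (e k : Fin n → CDC r) l * x k := by
  funext l
  rw [Finset.sum_apply, Finset.sum_eq_single l (fun j _ hj => by simp [hj.symm, zero_mul'])
    (by simp)]
  simp [one_mul']

theorem ofReal_eq_sum (x : Fin n → ℝ) : (ofReal x : Fin n → CDC r) = ∑ k, x k • e k := by
  funext l
  rw [Finset.sum_apply, Finset.sum_eq_single l (fun j _ hj => by simp [hj.symm]) (by simp)]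
  simp [ofReal]

theorem prod_e (G : CDOp r n h) (H : CDOp r m n) (k : Fin m) (l : Fin h) :
    prod G H (e k) l = G (H (e k)) l := ofMatrix_e _ k l

theorem prod_apply (G : CDOp r n h) (H : CDOp r m n) (x : Fin m → CDC r) (l : Fin h) :
    prod G H x l = ∑ k, G (H (e k)) l * x k := rfl

theorem adj_e (Q : CDOp r n h) (l : Fin h) (k : Fin n) :
    Q.adj (e l) k = (Q (e k) l).tilde := ofMatrix_e _ l k

theorem adj_apply (Q : CDOp r n h) (x : Fin h → CDC r) (k : Fin n) :
    Q.adj x k = ∑ l, (Q (e k) l).tilde * x l := rfl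

/-- Weak right linearity, used only for real basis vectors, already determines `J` by its matrix,
since `x = ∑_k e_k x_k`. -/
theorem Lr.apply_eq {J : CDOp r n h} (hJ : J ∈ Lr r n h) (x : Fin n → CDC r) (l : Fin h) :
    J x l = ∑ k, J (e k) l * x k := by
  conv_lhs => rw [eq_sum_e_mul x, map_sum, Finset.sum_apply]
  refine Finset.sum_congr rfl fun k _ => ?_
  have := congrFun (hJ (Pi.single k 1) 0 (x k) 0) l
  simpa [mul_zero', e] using this

theorem e_mem_realForm (k l : Fin n) : (e k : Fin n → CDC r) l ∈ realForm r := by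
  rw [e_apply]; split_ifs
  · exact one_mem_realForm
  · exact (realSub r).zero_mem

/-- The weight `∑_k |S V e_k|²` of an operator, the squared Hilbert-Schmidt norm of `{S V}`. -/
def weight (V : CDOp r n n) (S : CDOp r n h) : ℝ := ∑ k, normSq (S (V (e k)))

theorem weight_nonneg (V : CDOp r n n) (S : CDOp r n h) : 0 ≤ weight V S :=
  Finset.sum_nonneg fun _ _ => normSq_nonneg _

theorem tr_eq (Q : CDOp r n n) : tr Q = ∑ l, Q (e l) l := by
  refine Finset.sum_congr rfl fun l _ => ?_
  rw [form, Finset.sum_eq_single l (fun j _ hj => by simp [hj, tilde_zero, mul_zero']) (by simp)]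
  simp [tilde_one, mul_one']

theorem tr_prod_adj {V : CDOp r n n} (hV : ∀ k l, V (e k) l ∈ realForm r) {S : CDOp r n h}
    (hS : S ∈ Lri r n h) : tr (prod (prod S V) (prod V.adj S.adj)) = weight V S • (1 : CDC r) := by
  -- Entries in `A_r` are what allow `tilde` to reverse products.
  have hSe : ∀ k l, S (e k) l ∈ realForm r := fun k l => hS.2 _ (e_mem_realForm k) l
  have hadj : ∀ l k, V.adj (S.adj (e l)) k = (S (V (e k)) l).tilde := by
    intro l k
    rw [Lr.apply_eq hS.1 (V (e k)), tilde_sum, adj_apply]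
    refine Finset.sum_congr rfl fun m _ => ?_
    rw [adj_e, tilde_mul (hSe _ _) (hV _ _)]
  have hdiag : ∀ l, prod (prod S V) (prod V.adj S.adj) (e l) l =
      ∑ k, ‖S (V (e k)) l‖ ^ 2 • (1 : CDC r) := by
    intro l
    rw [prod_e, prod_apply]
    refine Finset.sum_congr rfl fun k _ => ?_
    rw [prod_e, hadj, mul_tilde_self (hS.2 _ (hV k) l)]
  simp only [tr_eq, hdiag, weight, normSq, Finset.sum_smul]
  exact Finset.sum_comm

theorem IsSqrt.apply_e_mem_realForm {U V : CDOp r n n} (hV : IsSqrt U V) (k l : Fin n) :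
    V (e k) l ∈ realForm r := by
  obtain ⟨p, d, σ, a, c, B, C, -, hc, -, -, -, rfl⟩ := hV
  rw [ofMatrix_e, blockSum, Matrix.blockDiagonal'_apply]
  split_ifs
  · exact (realSub r).smul_mem _ (hc _).1
  · exact (realSub r).zero_mem

theorem apply_ofReal_mem_realForm {V : CDOp r n n} (hV : ∀ k l, V (e k) l ∈ realForm r)
    (x : Fin n → ℝ) (l : Fin n) : V (ofReal x) l ∈ realForm r := by
  rw [ofReal_eq_sum, map_sum, Finset.sum_apply]
  refine (realSub r).sum_mem fun k _ => ?_
  rw [map_smul]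
  exact (realSub r).smul_mem _ (hV k l)

/-- The operators of `L_{r,i}` form a real subspace. -/
def LriSub (r n h : ℕ) : Submodule ℝ (CDOp r n h) where
  carrier := Lri r n h
  zero_mem' := ⟨fun x y b c => by funext l; simp [zero_mul'], fun x _ l => (realSub r).zero_mem⟩
  add_mem' := fun {J K} hJ hK => ⟨fun x y b c => by
      funext l
      simp only [_root_.add_apply, hJ.1 x y b c, hK.1 x y b c, Pi.add_apply, add_mul']
      abel, fun x hx l => (realSub r).add_mem (hJ.2 x hx l) (hK.2 x hx l)⟩
  smul_mem' := fun a J hJ => ⟨fun x y b c => by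
      funext l
      simp only [_root_.smul_apply, hJ.1 x y b c, Pi.smul_apply, real_smul_mul,
        smul_add], fun x hx l => (realSub r).smul_mem _ (hJ.2 x hx l)⟩

/-- The form as a continuous real-bilinear map. -/
def formL (r h : ℕ) : (Fin h → CDC r) →L[ℝ] (Fin h → CDC r) →L[ℝ] CDC r :=
  LinearMap.toContinuousLinearMap
    ((LinearMap.toContinuousLinearMap : ((Fin h → CDC r) →ₗ[ℝ] CDC r) ≃ₗ[ℝ] _).toLinearMap ∘ₗ
      LinearMap.mk₂ ℝ form
        (fun x y z => by simp [form, add_mul', Finset.sum_add_distrib])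
        (fun c x y => by simp [form, real_smul_mul, Finset.smul_sum])
        (fun x y z => by simp [form, tilde_add, mul_add', Finset.sum_add_distrib])
        (fun c x y => by simp [form, tilde_real_smul, mul_real_smul, Finset.smul_sum]))

@[simp] theorem formL_apply (x y : Fin h → CDC r) : formL r h x y = form x y := rfl

theorem continuous_normSq : Continuous (normSq : (Fin h → CDC r) → ℝ) := by
  unfold normSq; fun_prop

theorem continuous_weight (V : CDOp r n n) :
    Continuous (weight V : CDOp r n h → ℝ) := by
  unfold weight
  exact continuous_finsetSum _ fun k _ => continuous_normSq.comp (by fun_prop)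

/-- The norm on `A_{r,C}^h` is the maximum norm. This bound turns integrability of `normSq` into
square integrability in the Bochner sense. -/
theorem norm_sq_le_normSq (x : Fin h → CDC r) : ‖x‖ ^ 2 ≤ normSq x := by
  have h0 := normSq_nonneg x
  have : ‖x‖ ≤ Real.sqrt (normSq x) := by
    refine (pi_norm_le_iff_of_nonneg (Real.sqrt_nonneg _)).2 fun l => ?_
    refine Real.le_sqrt_of_sq_le ?_
    exact Finset.single_le_sum (f := fun l => ‖x l‖ ^ 2) (fun _ _ => by positivity)
      (Finset.mem_univ l)
  calc ‖x‖ ^ 2 ≤ Real.sqrt (normSq x) ^ 2 := by gcongr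
    _ = _ := Real.sq_sqrt h0

end CDOp

/-! ### Measurability and real coordinates -/

namespace CDOp

open CDC

variable {r n h : ℕ}

/-- The embedding of `ℝ^n` into `A_{r,C}^n` as a continuous linear map. -/
def ofRealL (r n : ℕ) : (Fin n → ℝ) →L[ℝ] (Fin n → CDC r) :=
  LinearMap.toContinuousLinearMap
    { toFun := ofReal
      map_add' := fun x y => by funext k; simp [ofReal, add_smul]
      map_smul' := fun c x => by funext k; simp [ofReal, mul_smul] }

@[simp] theorem ofRealL_apply (x : Fin n → ℝ) : ofRealL r n x = ofReal x := rfl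

theorem measurable_normSq : Measurable (normSq : (Fin h → CDC r) → ℝ) :=
  continuous_normSq.measurable

theorem measurable_weight (V : CDOp r n n) : Measurable (weight V : CDOp r n h → ℝ) :=
  (continuous_weight V).measurable

/-- Evaluation of a random operator at a random vector is measurable. -/
theorem measurable_apply₂ {α : Type*} {m : MeasurableSpace α} {S : α → CDOp r n h}
    {x : α → Fin n → CDC r} (hS : Measurable S) (hx : Measurable x) :
    Measurable fun ω => S ω (x ω) := by
  have hc : Continuous fun p : CDOp r n h × (Fin n → CDC r) => p.1 p.2 :=
    isBoundedBilinearMap_apply.continuous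
  exact hc.measurable.comp (hS.prodMk hx)

theorem normSq_eq_sum_re_im (x : Fin h → CDC r) :
    normSq x = ∑ l, ∑ s, (((x l).coord s).re ^ 2 + ((x l).coord s).im ^ 2) := by
  refine Finset.sum_congr rfl fun l _ => ?_
  rw [CDC.norm_sq]
  refine Finset.sum_congr rfl fun s _ => ?_
  rw [Complex.sq_norm, Complex.normSq_apply]
  ring

end CDOp

/-! ### Second moments of Gaussian vectors -/

section Gaussian

variable {n : ℕ} (v : NNReal)

theorem memLp_eval_pi_gaussianReal (k : Fin n) :
    MemLp (fun δ : Fin n → ℝ => δ k) 2 (Measure.pi fun _ => gaussianReal 0 v) :=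
  (memLp_id_gaussianReal' 2 (by simp)).comp_measurePreserving
    (measurePreserving_eval (fun _ : Fin n => gaussianReal 0 v) k)

theorem integral_eval_pi_gaussianReal (k : Fin n) :
    ∫ δ : Fin n → ℝ, δ k ∂(Measure.pi fun _ => gaussianReal 0 v) = 0 := by
  have := integral_comp_eval (μ := fun _ : Fin n => gaussianReal 0 v) (i := k) (f := id)
    aestronglyMeasurable_id
  simpa using this

/-- The second moment of an affine function of a centred Gaussian vector. -/
theorem integral_sq_affine_pi_gaussianReal (p : ℝ) (q : Fin n → ℝ) :
    Integrable (fun δ : Fin n → ℝ => (p + ∑ k, δ k * q k) ^ 2)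
        (Measure.pi fun _ => gaussianReal 0 v) ∧
      ∫ δ : Fin n → ℝ, (p + ∑ k, δ k * q k) ^ 2 ∂(Measure.pi fun _ => gaussianReal 0 v) =
        p ^ 2 + v * ∑ k, q k ^ 2 := by
  set γ : Measure (Fin n → ℝ) := Measure.pi fun _ => gaussianReal 0 v
  have hmem : MemLp (fun δ : Fin n → ℝ => ∑ k, δ k * q k) 2 γ :=
    memLp_finsetSum _ fun k _ => (memLp_eval_pi_gaussianReal v k).mul_const (q k)
  have hmean : ∫ δ : Fin n → ℝ, ∑ k, δ k * q k ∂γ = 0 := by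
    rw [integral_finsetSum _ fun k _ =>
      ((memLp_eval_pi_gaussianReal v k).mul_const (q k)).integrable (by norm_num)]
    refine Finset.sum_eq_zero fun k _ => ?_
    rw [integral_mul_const, integral_eval_pi_gaussianReal, zero_mul]
  -- The coordinates are independent under the product measure, so the variances `v q_k²` add up.
  have hvar : ∫ δ : Fin n → ℝ, (∑ k, δ k * q k) ^ 2 ∂γ = v * ∑ k, q k ^ 2 := by
    have h1 := variance_sum_pi (μ := fun _ : Fin n => gaussianReal 0 v)
      (X := fun k x => x * q k) fun k => (memLp_id_gaussianReal' 2 (by simp)).mul_const (q k)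
    have h2 : (∑ k, fun δ : Fin n → ℝ => δ k * q k) = fun δ => ∑ k, δ k * q k := by
      ext δ; simp
    rw [h2, variance_of_integral_eq_zero hmem.aestronglyMeasurable.aemeasurable hmean] at h1
    rw [h1, Finset.mul_sum]
    refine Finset.sum_congr rfl fun k _ => ?_
    rw [variance_mul_const]
    have := variance_id_gaussianReal (μ := 0) (v := v)
    exact congrArg (· * q k ^ 2) this |>.trans rfl
  have hint := (memLp_const p (μ := γ) (p := 2)).add hmem
  refine ⟨hint.integrable_sq, ?_⟩
  have hexp : ∀ δ : Fin n → ℝ, (p + ∑ k, δ k * q k) ^ 2 =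
      p ^ 2 + 2 * p * ∑ k, δ k * q k + (∑ k, δ k * q k) ^ 2 := fun δ => by ring
  simp only [hexp]
  rw [integral_add, integral_add, integral_const_mul, hmean, hvar]
  · simp
  · exact integrable_const _
  · exact (hmem.integrable (by norm_num)).const_mul _
  · exact (integrable_const _).add ((hmem.integrable (by norm_num)).const_mul _)
  · exact hmem.integrable_sq

open CDOp in
/-- The second moment of an affine function of a centred Gaussian vector, with values in
`A_{r,C}^h`. -/
theorem lintegral_normSq_add_pi_gaussianReal {r h : ℕ} (x : Fin h → CDC r) (J : CDOp r n h) :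
    ∫⁻ δ : Fin n → ℝ, ENNReal.ofReal (normSq (x + J (ofReal δ)))
        ∂(Measure.pi fun _ => gaussianReal 0 v) =
      ENNReal.ofReal (normSq x + v * ∑ k, normSq (J (e k))) := by
  set γ : Measure (Fin n → ℝ) := Measure.pi fun _ => gaussianReal 0 v
  -- Each real or imaginary part of each coefficient is a real affine function of `δ`, so the scalar
  -- formula applies to it; the rest rearranges finite sums.
  have hcoord : ∀ (δ : Fin n → ℝ) l s, ((x + J (ofReal δ)) l).coord s =
      (x l).coord s + ∑ k, δ k * (J (e k) l).coord s := by
    intro δ l s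
    rw [ofReal_eq_sum, map_sum]
    simp
  have hre : ∀ (δ : Fin n → ℝ) l s, (((x + J (ofReal δ)) l).coord s).re =
      ((x l).coord s).re + ∑ k, δ k * ((J (e k) l).coord s).re := by
    intro δ l s; rw [hcoord]; simp
  have him : ∀ (δ : Fin n → ℝ) l s, (((x + J (ofReal δ)) l).coord s).im =
      ((x l).coord s).im + ∑ k, δ k * ((J (e k) l).coord s).im := by
    intro δ l s; rw [hcoord]; simp
  have hR := fun l s => integral_sq_affine_pi_gaussianReal v ((x l).coord s).re
    fun k => ((J (e k) l).coord s).re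
  have hI := fun l s => integral_sq_affine_pi_gaussianReal v ((x l).coord s).im
    fun k => ((J (e k) l).coord s).im
  have hint : Integrable (fun δ : Fin n → ℝ => normSq (x + J (ofReal δ))) γ := by
    simp only [normSq_eq_sum_re_im, hre, him]
    exact integrable_finsetSum _ fun l _ => integrable_finsetSum _ fun s _ =>
      (hR l s).1.add (hI l s).1
  rw [← ofReal_integral_eq_lintegral_ofReal hint (ae_of_all _ fun δ => normSq_nonneg _)]
  congr 1
  simp only [normSq_eq_sum_re_im, hre, him]
  have hRI := fun l s => (hR l s).1.add (hI l s).1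
  simp only [Pi.add_def] at hRI
  rw [integral_finsetSum _ fun l _ => integrable_finsetSum _ fun s _ => hRI l s]
  simp_rw [Finset.mul_sum]
  rw [Finset.sum_comm (s := (Finset.univ : Finset (Fin n))), ← Finset.sum_add_distrib]
  refine Finset.sum_congr rfl fun l _ => ?_
  rw [integral_finsetSum _ fun s _ => hRI l s,
    Finset.sum_comm (s := (Finset.univ : Finset (Fin n))), ← Finset.sum_add_distrib]
  refine Finset.sum_congr rfl fun s _ => ?_
  rw [integral_add (hR l s).1 (hI l s).1, (hR l s).2, (hI l s).2]
  simp only [mul_add, Finset.sum_add_distrib, Finset.mul_sum]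
  ring

end Gaussian

/-! ### Freezing an independent variable -/

section Independence

/-- Tonelli's theorem for a function of a `G`-measurable variable and a variable independent
of `G`. -/
theorem lintegral_indep_eq {Ω β γ : Type*} {G mΩ : MeasurableSpace Ω} [MeasurableSpace β]
    [MeasurableSpace γ] {P : Measure Ω} [IsProbabilityMeasure P]
    (hG : G ≤ mΩ) {Z : Ω → β} (hZ : Measurable[G] Z) {Δ : Ω → γ} (hΔ : Measurable Δ)
    (hind : Indep (MeasurableSpace.comap Δ inferInstance) G P) {f : β × γ → ℝ≥0∞}
    (hf : Measurable f) :
    ∫⁻ ω, f (Z ω, Δ ω) ∂P = ∫⁻ ω, ∫⁻ δ, f (Z ω, δ) ∂(P.map Δ) ∂P := by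
  have hZ' : Measurable Z := hZ.mono hG le_rfl
  have hI : IndepFun Z Δ P := by
    rw [IndepFun_iff_Indep]
    exact indep_of_indep_of_le_left hind.symm hZ.comap_le
  have hmap := (indepFun_iff_map_prod_eq_prod_map_map hZ'.aemeasurable hΔ.aemeasurable).1 hI
  have : IsProbabilityMeasure (P.map Δ) := Measure.isProbabilityMeasure_map hΔ.aemeasurable
  rw [← lintegral_map hf (hZ'.prodMk hΔ), hmap, lintegral_prod _ hf.aemeasurable,
    lintegral_map hf.lintegral_prod_right' hZ']

end Independence

/-! ### The isometry and the zero conditional mean along a partition -/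

section Wiener

open CDOp

variable {Ω : Type*} {mΩ : MeasurableSpace Ω} {T : Set ℝ} {r n h : ℕ} {P : Measure Ω}
  {F : Filtration T mΩ} {V : CDOp r n n} {w : T → Ω → (Fin n → CDC r)}

namespace IsURandom

theorem measurable (hw : IsURandom P F V w) (t : T) : Measurable (w t) :=
  (hw.adapted t).mono (F.le t) le_rfl

theorem ae_realForm (hw : IsURandom P F V w) (hV : ∀ k l, V (e k) l ∈ CDC.realForm r) (t : T) :
    ∀ᵐ ω ∂P, ∀ k, w t ω k ∈ CDC.realForm r := by
  obtain ⟨ξ, -, hξ⟩ := hw.wiener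
  filter_upwards [hξ t] with ω hω k
  rw [hω]
  exact apply_ofReal_mem_realForm hV _ _

/-- The law of an increment. -/
theorem map_sub (hw : IsURandom P F V w) {u t : T} (hut : u ≤ t) :
    P.map (fun ω => w t ω - w u ω) =
      (Measure.pi fun _ : Fin n => gaussianReal 0 (Real.toNNReal ((t : ℝ) - u))).map
        (fun δ => V (ofReal δ)) := by
  obtain ⟨ξ, h1, h2⟩ := hw.wiener
  have hm : Measurable fun δ : Fin n → ℝ => V (ofReal δ) := (V ∘L ofRealL r n).measurable
  have hξ : AEMeasurable (fun ω => ξ t ω - ξ u ω) P :=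
    (h1.aemeasurable t).sub (h1.aemeasurable u)
  rw [← h1.law u t hut, AEMeasurable.map_map_of_aemeasurable hm.aemeasurable hξ]
  refine Measure.map_congr ?_
  filter_upwards [h2 t, h2 u] with ω ht hu
  rw [ht, hu]
  exact (_root_.map_sub (V ∘L ofRealL r n) (ξ t ω) (ξ u ω)).symm

/-- An increment is integrable with mean zero. -/
theorem integral_sub_eq_zero (hw : IsURandom P F V w) {u t : T} (hut : u ≤ t) :
    Integrable (fun ω => w t ω - w u ω) P ∧ ∫ ω, (w t ω - w u ω) ∂P = 0 := by
  have hmeas : Measurable fun ω => w t ω - w u ω := (hw.measurable t).sub (hw.measurable u)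
  set v := Real.toNNReal ((t : ℝ) - u)
  have hid : Integrable (fun δ : Fin n → ℝ => δ) (Measure.pi fun _ => gaussianReal 0 v) :=
    Integrable.of_eval fun k => (memLp_eval_pi_gaussianReal v k).integrable (by norm_num)
  have hzero : ∫ δ : Fin n → ℝ, δ ∂(Measure.pi fun _ => gaussianReal 0 v) = 0 := by
    funext k
    rw [eval_integral fun k => (memLp_eval_pi_gaussianReal v k).integrable (by norm_num)]
    exact integral_eval_pi_gaussianReal v k
  have hm : Measurable (V ∘L ofRealL r n) := (V ∘L ofRealL r n).measurable
  have hmap : P.map (fun ω => w t ω - w u ω) =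
      (Measure.pi fun _ : Fin n => gaussianReal 0 v).map (V ∘L ofRealL r n) := hw.map_sub hut
  have hsm : AEStronglyMeasurable (fun x : Fin n → CDC r => x)
      (P.map fun ω => w t ω - w u ω) := aestronglyMeasurable_id
  constructor
  · refine (integrable_map_measure hsm hmeas.aemeasurable).1 ?_
    rw [hmap] at hsm ⊢
    exact (integrable_map_measure hsm hm.aemeasurable).2
      ((V ∘L ofRealL r n).integrable_comp hid)
  · rw [← integral_map hmeas.aemeasurable hsm]
    rw [hmap] at hsm ⊢
    rw [integral_map hm.aemeasurable hsm, (V ∘L ofRealL r n).integral_comp_comm hid, hzero,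
      map_zero]

/-- One step of the isometry. No integrability is needed. -/
theorem setLIntegral_normSq_add [IsProbabilityMeasure P] (hw : IsURandom P F V w) {u t : T}
    (hut : u < t) {A : Set Ω} (hA : MeasurableSet[F u] A) {X : Ω → Fin h → CDC r}
    (hX : Measurable[F u] X) {S : Ω → CDOp r n h} (hS : Measurable[F u] S) :
    ∫⁻ ω in A, ENNReal.ofReal (normSq (X ω + S ω (w t ω - w u ω))) ∂P =
      ∫⁻ ω in A, ENNReal.ofReal (normSq (X ω) + ((t : ℝ) - u) * weight V (S ω)) ∂P := by
  have hA' : MeasurableSet A := F.le u _ hA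
  -- The indicator of `A` joins `X` and `S` as a third `F u`-measurable variable, so that the
  -- integral over `A` becomes an integral over `Ω` to which independence applies.
  let f : (ℝ≥0∞ × (Fin h → CDC r) × CDOp r n h) × (Fin n → CDC r) → ℝ≥0∞ :=
    fun p => p.1.1 * ENNReal.ofReal (normSq (p.1.2.1 + p.1.2.2 p.2))
  have hf : Measurable f := by
    refine (measurable_fst.comp measurable_fst).mul (ENNReal.measurable_ofReal.comp
      (measurable_normSq.comp (Measurable.add ?_ (measurable_apply₂ ?_ ?_)))) <;> fun_prop
  have hind1 : Measurable[F u] (A.indicator (1 : Ω → ℝ≥0∞)) :=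
    Measurable.indicator measurable_const hA
  have key := lintegral_indep_eq (P := P) (F.le u) (hind1.prodMk (hX.prodMk hS))
    ((hw.measurable t).sub (hw.measurable u)) (hw.indep u t hut) hf
  have hleft : ∀ (g : Ω → ℝ≥0∞), ∫⁻ ω in A, g ω ∂P = ∫⁻ ω, A.indicator 1 ω * g ω ∂P := by
    intro g
    rw [← lintegral_indicator hA']
    refine lintegral_congr fun ω => ?_
    by_cases hω : ω ∈ A <;> simp [hω]
  rw [hleft, hleft]
  refine key.trans (lintegral_congr fun ω => ?_)
  have hV : Measurable fun δ : Fin n → ℝ => V (ofReal δ) := (V ∘L ofRealL r n).measurable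
  have hfω : Measurable fun δ => f ((A.indicator 1 ω, X ω, S ω), δ) := by fun_prop
  have h0 : (0 : ℝ) ≤ (t : ℝ) - u := sub_nonneg.2 hut.le
  have hlaw : P.map (w t - w u) = P.map (fun ω => w t ω - w u ω) := rfl
  rw [hlaw, hw.map_sub hut.le, lintegral_map hfω hV]
  simp only [f]
  rw [lintegral_const_mul]
  · congr 1
    rw [show (∫⁻ δ : Fin n → ℝ, ENNReal.ofReal (normSq (X ω + S ω (V (ofReal δ))))
        ∂(Measure.pi fun _ => gaussianReal 0 (Real.toNNReal ((t : ℝ) - u)))) = _ from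
        lintegral_normSq_add_pi_gaussianReal _ (X ω) (S ω ∘L V), Real.coe_toNNReal _ h0]
    rfl
  · exact ENNReal.measurable_ofReal.comp (measurable_normSq.comp
      (measurable_const.add ((S ω).measurable.comp hV)))

/-- The term of an elementary integral is integrable with conditional mean zero as soon as its
squared norm is integrable. -/
theorem condExp_apply_sub_eq_zero [IsProbabilityMeasure P] (hw : IsURandom P F V w) {u t : T}
    (hut : u < t) {S : Ω → CDOp r n h} (hS : Measurable[F u] S)
    (hint : Integrable (fun ω => ((t : ℝ) - u) * weight V (S ω)) P) :
    Integrable (fun ω => S ω (w t ω - w u ω)) P ∧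
      P[fun ω => S ω (w t ω - w u ω) | F u] =ᵐ[P] 0 := by
  have hΔ : Measurable fun ω => w t ω - w u ω := (hw.measurable t).sub (hw.measurable u)
  have hm : Measurable fun ω => S ω (w t ω - w u ω) :=
    measurable_apply₂ (hS.mono (F.le u) le_rfl) hΔ
  have hI : Integrable (fun ω => S ω (w t ω - w u ω)) P := by
    have hsq : Integrable (fun ω => normSq (S ω (w t ω - w u ω))) P := by
      refine ⟨(measurable_normSq.comp hm).aestronglyMeasurable, ?_⟩
      -- The one-step isometry with `X = 0` and `A = Ω` bounds the second moment of the term by the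
      -- integrable weight.
      have key := hw.setLIntegral_normSq_add hut MeasurableSet.univ
        (X := fun _ => (0 : Fin h → CDC r)) measurable_const hS
      have hz : normSq (0 : Fin h → CDC r) = 0 := by simp [normSq]
      simp only [zero_add, hz, Measure.restrict_univ] at key
      rw [hasFiniteIntegral_iff_ofReal (ae_of_all _ fun ω => normSq_nonneg _), key]
      refine (hasFiniteIntegral_iff_ofReal (ae_of_all _ fun ω => ?_)).1 hint.2
      exact mul_nonneg (sub_nonneg.2 hut.le) (weight_nonneg _ _)
    have hn : Integrable (fun ω => ‖S ω (w t ω - w u ω)‖ ^ 2) P :=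
      hsq.mono' (hm.norm.pow_const 2).aestronglyMeasurable (ae_of_all _ fun ω => by
        rw [Real.norm_of_nonneg (by positivity)]
        exact norm_sq_le_normSq _)
    exact ((memLp_two_iff_integrable_sq_norm hm.aestronglyMeasurable).2 hn).integrable (by norm_num)
  refine ⟨hI, ?_⟩
  obtain ⟨hΔi, hΔ0⟩ := hw.integral_sub_eq_zero hut.le
  -- `S` is `F u`-measurable and comes out of the conditional expectation; what is left is that of
  -- the increment, which by independence is its mean, zero.
  have h1 := condExp_bilin_of_aestronglyMeasurable_left (m := F u)
    (ContinuousLinearMap.id ℝ (CDOp r n h)) hS.stronglyMeasurable.aestronglyMeasurable hI hΔi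
  have h2 := condExp_indep_eq hΔ.comap_le (F.le u)
    (comap_measurable fun ω => w t ω - w u ω).stronglyMeasurable (hw.indep u t hut)
  refine h1.trans ?_
  filter_upwards [h2] with ω hω
  rw [hω, hΔ0]
  simp

variable {α : ℕ → T} {S : ℕ → Ω → CDOp r n h}

/-- A term of an elementary integral is measurable at its right end point. -/
theorem measurable_term (hw : IsURandom P F V w) (hα : Monotone α)
    (hS : ∀ m, α m < α (m + 1) → Measurable[F (α m)] (S m)) (m : ℕ) :
    Measurable[F (α (m + 1))] fun ω => S m ω (w (α (m + 1)) ω - w (α m) ω) := by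
  rcases (hα (Nat.le_add_right m 1)).lt_or_eq with hlt | heq
  · exact measurable_apply₂ ((hS m hlt).mono (F.mono hlt.le) le_rfl)
      ((hw.adapted _).sub ((hw.adapted _).mono (F.mono hlt.le) le_rfl))
  -- On a degenerate interval nothing is known about the measurability of `S m`, but the increment
  -- vanishes.
  · have : (fun ω => S m ω (w (α (m + 1)) ω - w (α m) ω)) = fun _ => 0 := by
      funext ω; simp [← heq]
    rw [this]
    exact measurable_const

/-- Adaptedness of the partial sums, which lets them play the role of `X` in the one-step isometry.
-/
theorem measurable_sum_term (hw : IsURandom P F V w) (hα : Monotone α)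
    (hS : ∀ m, α m < α (m + 1) → Measurable[F (α m)] (S m)) (m : ℕ) :
    Measurable[F (α m)] fun ω =>
      ∑ l ∈ Finset.range m, S l ω (w (α (l + 1)) ω - w (α l) ω) :=
  Finset.measurable_fun_sum _ fun l hl => (hw.measurable_term hα hS l).mono
    (F.mono (hα (Finset.mem_range.1 hl))) le_rfl

theorem measurable_weight_term (hα : Monotone α)
    (hS : ∀ m, α m < α (m + 1) → Measurable[F (α m)] (S m)) (m : ℕ) :
    Measurable fun ω => ((α (m + 1) : ℝ) - α m) * weight V (S m ω) := by
  rcases (hα (Nat.le_add_right m 1)).lt_or_eq with hlt | heq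
  · exact ((measurable_weight V).comp ((hS m hlt).mono (F.le _) le_rfl)).const_mul _
  · have : (fun ω => ((α (m + 1) : ℝ) - α m) * weight V (S m ω)) = fun _ => 0 := by
      funext ω; simp [← heq]
    rw [this]
    exact measurable_const

theorem weight_term_nonneg (hα : Monotone α) (m : ℕ) (ω : Ω) :
    0 ≤ ((α (m + 1) : ℝ) - α m) * weight V (S m ω) :=
  mul_nonneg (sub_nonneg.2 (hα m.le_succ)) (weight_nonneg _ _)

/-- The isometry on the sets of the initial σ-algebra, with values in `[0, ∞]`. -/
theorem setLIntegral_normSq_sum [IsProbabilityMeasure P] (hw : IsURandom P F V w)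
    (hα : Monotone α) (hS : ∀ m, α m < α (m + 1) → Measurable[F (α m)] (S m)) {A : Set Ω}
    (hA : MeasurableSet[F (α 0)] A) (m : ℕ) :
    ∫⁻ ω in A, ENNReal.ofReal
        (normSq (∑ l ∈ Finset.range m, S l ω (w (α (l + 1)) ω - w (α l) ω))) ∂P =
      ∫⁻ ω in A, ENNReal.ofReal
        (∑ l ∈ Finset.range m, ((α (l + 1) : ℝ) - α l) * weight V (S l ω)) ∂P := by
  induction m with
  | zero => simp [normSq]
  | succ m ih =>
    have hw0 := fun ω => weight_term_nonneg (V := V) (S := S) hα m ω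
    simp only [Finset.sum_range_succ]
    have hX := hw.measurable_sum_term hα hS m
    -- The induction hypothesis replaces the earlier weights by the squared norm of the partial sum,
    -- leaving exactly the right-hand side of the one-step isometry.
    have hsplit : ∫⁻ ω in A, ENNReal.ofReal
        (∑ l ∈ Finset.range m, ((α (l + 1) : ℝ) - α l) * weight V (S l ω) +
          ((α (m + 1) : ℝ) - α m) * weight V (S m ω)) ∂P =
        ∫⁻ ω in A, ENNReal.ofReal
        (normSq (∑ l ∈ Finset.range m, S l ω (w (α (l + 1)) ω - w (α l) ω)) +
          ((α (m + 1) : ℝ) - α m) * weight V (S m ω)) ∂P := by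
      have hmeas := ENNReal.measurable_ofReal.comp (measurable_weight_term (V := V) hα hS m)
      have hadd1 := fun ω => ENNReal.ofReal_add (Finset.sum_nonneg fun l (_ : l ∈ Finset.range m) =>
        weight_term_nonneg (V := V) (S := S) hα l ω) (hw0 ω)
      have hadd2 := fun ω => ENNReal.ofReal_add (normSq_nonneg
        (∑ l ∈ Finset.range m, S l ω (w (α (l + 1)) ω - w (α l) ω))) (hw0 ω)
      rw [lintegral_congr hadd1, lintegral_congr hadd2]
      exact (lintegral_add_right _ hmeas).trans
        ((congrArg (· + _) ih.symm).trans (lintegral_add_right _ hmeas).symm)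
    rw [hsplit]
    rcases (hα (Nat.le_add_right m 1)).lt_or_eq with hlt | heq
    · exact hw.setLIntegral_normSq_add hlt (F.mono (hα (Nat.zero_le m)) _ hA) hX (hS m hlt)
    · simp [← heq]

/-- The elementary integral has conditional mean zero if its quadratic variation is integrable. -/
theorem condExp_sum_eq_zero [IsProbabilityMeasure P] (hw : IsURandom P F V w)
    (hα : Monotone α) (hS : ∀ m, α m < α (m + 1) → Measurable[F (α m)] (S m)) (m : ℕ)
    (hint : Integrable
      (fun ω => ∑ l ∈ Finset.range m, ((α (l + 1) : ℝ) - α l) * weight V (S l ω)) P) :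
    Integrable (fun ω => ∑ l ∈ Finset.range m, S l ω (w (α (l + 1)) ω - w (α l) ω)) P ∧
      P[fun ω => ∑ l ∈ Finset.range m, S l ω (w (α (l + 1)) ω - w (α l) ω) | F (α 0)] =ᵐ[P] 0 := by
  have hterm : ∀ l ∈ Finset.range m, Integrable (fun ω => S l ω (w (α (l + 1)) ω - w (α l) ω)) P ∧
      P[fun ω => S l ω (w (α (l + 1)) ω - w (α l) ω) | F (α 0)] =ᵐ[P] 0 := by
    intro l hl
    rcases (hα (Nat.le_add_right l 1)).lt_or_eq with hlt | heq
    · have hi : Integrable (fun ω => ((α (l + 1) : ℝ) - α l) * weight V (S l ω)) P := by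
        refine hint.mono' (measurable_weight_term hα hS l).aestronglyMeasurable
          (ae_of_all _ fun ω => ?_)
        rw [Real.norm_of_nonneg (weight_term_nonneg hα l ω)]
        exact Finset.single_le_sum
          (f := fun l => ((α (l + 1) : ℝ) - α l) * weight V (S l ω))
          (fun j _ => weight_term_nonneg hα j ω) hl
      obtain ⟨h1, h2⟩ := hw.condExp_apply_sub_eq_zero hlt (hS l hlt) hi
      -- Tower property: the mean given `F (α l)` vanishes, hence so does the mean given the smaller
      -- `F (α 0)`.
      refine ⟨h1, (condExp_condExp_of_le (F.mono (hα (Nat.zero_le l))) (F.le _)).symm.trans ?_⟩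
      refine (condExp_congr_ae h2).trans ?_
      rw [condExp_zero]
    · have : (fun ω => S l ω (w (α (l + 1)) ω - w (α l) ω)) = 0 := by
        funext ω; simp [← heq]
      rw [this, condExp_zero]
      exact ⟨integrable_zero _ _ _, EventuallyEq.rfl⟩
  refine ⟨integrable_finsetSum _ fun l hl => (hterm l hl).1, ?_⟩
  have h1 := condExp_finsetSum (fun l hl => (hterm l hl).1) (F (α 0))
  have h2 : (∑ l ∈ Finset.range m, fun ω => S l ω (w (α (l + 1)) ω - w (α l) ω)) =
      fun ω => ∑ l ∈ Finset.range m, S l ω (w (α (l + 1)) ω - w (α l) ω) := by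
    funext ω; simp
  rw [h2] at h1
  refine h1.trans ?_
  have h3 : ∀ᵐ ω ∂P, ∀ l ∈ Finset.range m,
      P[fun ω => S l ω (w (α (l + 1)) ω - w (α l) ω) | F (α 0)] ω = 0 :=
    (ae_ball_iff (Finset.range m).countable_toSet).2 fun l hl => (hterm l hl).2
  filter_upwards [h3] with ω hω
  rw [Finset.sum_apply]
  exact Finset.sum_eq_zero hω

end IsURandom

end Wiener

/-! ### From integrals over sets to conditional expectations -/

section CondExp

variable {Ω : Type*} {m mΩ : MeasurableSpace Ω} {P : Measure Ω} [IsProbabilityMeasure P]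

/-- Two functions with the same integrals over the sets of `m` have the same conditional
expectation with values in `[0, ∞]`. -/
theorem condLExp_ae_eq_of_setLIntegral_eq (hm : m ≤ mΩ) {f g : Ω → ℝ≥0∞}
    (hfg : ∀ A, MeasurableSet[m] A → ∫⁻ ω in A, f ω ∂P = ∫⁻ ω in A, g ω ∂P) :
    condLExp m P f =ᵐ[P] condLExp m P g := by
  refine ae_eq_condLExp hm P g (measurable_condLExp m P f) fun A hA => ?_
  rw [setLIntegral_condLExp hm P f hA, hfg A hA]

/-- Two non-negative functions with the same `[0, ∞]`-valued integrals over the sets of `m` are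
integrable at the same time and have the same conditional expectation. -/
theorem condExp_smul_ae_eq_of_setLIntegral_eq {E : Type*} [NormedAddCommGroup E] [NormedSpace ℝ E]
    [CompleteSpace E] {c : E} (hc : c ≠ 0) (hm : m ≤ mΩ) {f g : Ω → ℝ} (hf : Measurable f)
    (hg : Measurable g) (hf0 : ∀ ω, 0 ≤ f ω) (hg0 : ∀ ω, 0 ≤ g ω)
    (hfg : ∀ A, MeasurableSet[m] A →
      ∫⁻ ω in A, ENNReal.ofReal (f ω) ∂P = ∫⁻ ω in A, ENNReal.ofReal (g ω) ∂P) :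
    (Integrable (fun ω => f ω • c) P ↔ Integrable (fun ω => g ω • c) P) ∧
      P[fun ω => f ω • c | m] =ᵐ[P] P[fun ω => g ω • c | m] := by
  have hiff : Integrable (fun ω => f ω • c) P ↔ Integrable (fun ω => g ω • c) P := by
    rw [integrable_smul_const hc, integrable_smul_const hc]
    have huniv := hfg Set.univ MeasurableSet.univ
    rw [Measure.restrict_univ] at huniv
    simp only [Integrable, hf.aestronglyMeasurable, hg.aestronglyMeasurable, true_and,
      hasFiniteIntegral_iff_ofReal (ae_of_all P hf0),
      hasFiniteIntegral_iff_ofReal (ae_of_all P hg0), huniv]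
  refine ⟨hiff, ?_⟩
  by_cases hi : Integrable (fun ω => f ω • c) P
  · refine ae_eq_condExp_of_forall_setIntegral_eq hm (hiff.1 hi)
      (fun A _ _ => integrable_condExp.integrableOn) (fun A hA _ => ?_)
      stronglyMeasurable_condExp.aestronglyMeasurable
    rw [setIntegral_condExp hm hi hA, integral_smul_const, integral_smul_const,
      integral_eq_lintegral_of_nonneg_ae (ae_of_all _ hf0) hf.aestronglyMeasurable,
      integral_eq_lintegral_of_nonneg_ae (ae_of_all _ hg0) hg.aestronglyMeasurable, hfg A hA]
  -- Neither side is integrable, and both conditional expectations are `0` by convention.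
  · rw [condExp_of_not_integrable hi, condExp_of_not_integrable fun h => hi (hiff.2 h)]

end CondExp

/-! ### Elementary integrals on the partition of `[a, t]` -/

namespace ElementaryProcess

open CDOp

variable {Ω : Type*} {mΩ : MeasurableSpace Ω} {T : Set ℝ} {r n h : ℕ} {F : Filtration T mΩ}

/-- The partition points, continued by the last one and confined to `[a, t]`. -/
def clampedPt (S : ElementaryProcess F r n h) (a t : T) (m : ℕ) : T :=
  max a (min (S.pt ⟨min m S.k, Nat.lt_succ_of_le (min_le_right _ _)⟩) t)

/-- The coefficients, continued by zero. -/
def coefNat (S : ElementaryProcess F r n h) (m : ℕ) : Ω → CDOp r n h :=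
  if hm : m < S.k then S.coef ⟨m, hm⟩ else 0

variable (S : ElementaryProcess F r n h) {a t : T}

theorem clampedPt_of_fin (l : Fin S.k) :
    S.clampedPt a t l = max a (min (S.pt l.castSucc) t) := by
  have : (⟨min (l : ℕ) S.k, Nat.lt_succ_of_le (min_le_right _ _)⟩ : Fin (S.k + 1)) = l.castSucc :=
    Fin.ext (min_eq_left l.2.le)
  rw [clampedPt, this]

theorem clampedPt_succ_of_fin (l : Fin S.k) :
    S.clampedPt a t (l + 1) = max a (min (S.pt l.succ) t) := by
  have : (⟨min ((l : ℕ) + 1) S.k, Nat.lt_succ_of_le (min_le_right _ _)⟩ : Fin (S.k + 1)) = l.succ :=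
    Fin.ext (min_eq_left l.2)
  rw [clampedPt, this]

theorem coefNat_of_fin (l : Fin S.k) : S.coefNat l = S.coef l := by
  simp [coefNat]

theorem monotone_clampedPt : Monotone (S.clampedPt a t) := fun _ _ hij =>
  max_le_max le_rfl (min_le_min (S.pt_strictMono.monotone
    (Fin.mk_le_mk.2 (min_le_min hij le_rfl))) le_rfl)

theorem clampedPt_zero (ha : 0 ≤ (a : ℝ)) : S.clampedPt a t 0 = a := by
  refine max_eq_left ((min_le_left _ _).trans ?_)
  have : (⟨min 0 S.k, Nat.lt_succ_of_le (min_le_right _ _)⟩ : Fin (S.k + 1)) = 0 :=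
    Fin.ext (min_eq_left (Nat.zero_le _))
  rw [this, ← Subtype.coe_le_coe, S.pt_zero]
  exact ha

theorem coefNat_mem (m : ℕ) (ω : Ω) : S.coefNat m ω ∈ Lri r n h := by
  unfold coefNat
  split_ifs
  · exact S.coef_mem _ ω
  · exact (LriSub r n h).zero_mem

/-- The coefficient is measurable at its own partition point `t_m`, so `t_m` must not exceed the
clamped point. This can fail if `t_m > t`, but then the clamped interval is degenerate; hence the
strict inequality assumed. -/
theorem measurable_coefNat (m : ℕ) (hlt : S.clampedPt a t m < S.clampedPt a t (m + 1))
    (hat : a ≤ t) : Measurable[F (S.clampedPt a t m)] (S.coefNat m) := by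
  by_cases hm : m < S.k
  · have hle : S.pt (Fin.castSucc ⟨m, hm⟩) ≤ S.clampedPt a t m := by
      have h1 := S.clampedPt_of_fin (a := a) (t := t) ⟨m, hm⟩
      have h2 : S.clampedPt a t (m + 1) ≤ t := max_le hat (min_le_right _ _)
      dsimp only at h1
      rw [h1] at hlt ⊢
      have h3 : min (S.pt (Fin.castSucc ⟨m, hm⟩)) t < t :=
        (le_max_right _ _).trans_lt (hlt.trans_le h2)
      rw [min_eq_left ((min_lt_iff.1 h3).resolve_right (lt_irrefl t)).le]
      exact le_max_right _ _
    have := S.measurable_coef ⟨m, hm⟩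
    rw [← S.coefNat_of_fin] at this
    exact this.mono (F.mono hle) le_rfl
  · have : S.coefNat m = fun _ => 0 := by simp [coefNat, hm]; rfl
    rw [this]
    exact measurable_const

/-- The integral over `[a, t]` in terms of the partition of `[a, t]`. -/
theorem integral_eq_sum (w : T → Ω → (Fin n → CDC r)) (hat : a ≤ t) (ω : Ω) :
    S.integral w a t ω = ∑ l ∈ Finset.range S.k, S.coefNat l ω
      (w (S.clampedPt a t (l + 1)) ω - w (S.clampedPt a t l) ω) := by
  have hw : ∀ p : T, w (min p t) ω - w (min p a) ω = w (max a (min p t)) ω - w a ω := by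
    intro p
    rcases le_total p a with hp | hp
    · rw [min_eq_left hp, min_eq_left (hp.trans hat), max_eq_left hp, sub_self, sub_self]
    · rw [min_eq_right hp, max_eq_right (le_min hp hat)]
  rw [integral, integralTo, integralTo, ← Finset.sum_sub_distrib, Finset.sum_range]
  refine Finset.sum_congr rfl fun l _ => ?_
  rw [← map_sub, S.coefNat_of_fin, S.clampedPt_of_fin, S.clampedPt_succ_of_fin]
  congr 1
  rw [sub_sub_sub_comm, hw, hw, sub_sub_sub_cancel_right]

theorem measurable_integralTo {P : Measure Ω} {V : CDOp r n n} {w : T → Ω → (Fin n → CDC r)}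
    (hw : IsURandom P F V w) (a : T) : Measurable[F a] (S.integralTo w a) := by
  refine Finset.measurable_fun_sum _ fun l _ => ?_
  have hwm : ∀ p, Measurable[F a] (w (min p a)) := fun p =>
    (hw.adapted _).mono (F.mono (min_le_right _ _)) le_rfl
  rcases le_total (S.pt l.castSucc) a with hl | hl
  · exact measurable_apply₂ ((S.measurable_coef l).mono (F.mono hl) le_rfl) ((hwm _).sub (hwm _))
  -- An interval starting at or after `a` contributes nothing to the integral up to `a`.
  · have hl' : a ≤ S.pt l.succ := hl.trans (S.pt_strictMono.monotone l.castSucc_le_succ)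
    simp only [min_eq_right hl, min_eq_right hl', sub_self, map_zero]
    exact measurable_const

theorem value_mem (τ : ℝ) (ω : Ω) : S.value τ ω ∈ Lri r n h := by
  refine (LriSub r n h).sum_mem fun l _ => ?_
  rw [Set.indicator_apply]
  split_ifs
  · exact S.coef_mem l ω
  · exact (LriSub r n h).zero_mem

/-- The weight is quadratic in `S`, yet passes through the sum because the intervals are disjoint:
at most one summand is non-zero at each `τ`. -/
theorem weight_value (V : CDOp r n n) (τ : ℝ) (ω : Ω) :
    weight V (S.value τ ω) = ∑ l, Set.indicator (Set.Ioc (S.pt l.castSucc : ℝ) (S.pt l.succ : ℝ))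
      (fun _ => weight V (S.coef l ω)) τ := by
  by_cases hτ : ∃ l : Fin S.k, τ ∈ Set.Ioc (S.pt l.castSucc : ℝ) (S.pt l.succ : ℝ)
  · obtain ⟨l, hl⟩ := hτ
    have hne : ∀ j, j ≠ l → τ ∉ Set.Ioc (S.pt j.castSucc : ℝ) (S.pt j.succ : ℝ) := by
      intro j hj hτj
      rcases lt_or_gt_of_ne hj with hlt | hlt
      · have : (S.pt j.succ : ℝ) ≤ S.pt l.castSucc :=
          S.pt_strictMono.monotone (Fin.succ_le_castSucc_iff.2 hlt)
        exact absurd (hτj.2.trans this) (not_le.2 hl.1)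
      · have : (S.pt l.succ : ℝ) ≤ S.pt j.castSucc :=
          S.pt_strictMono.monotone (Fin.succ_le_castSucc_iff.2 hlt)
        exact absurd (hl.2.trans this) (not_le.2 hτj.1)
    rw [value,
      Finset.sum_eq_single l (fun j _ hj => Set.indicator_of_notMem (hne j hj) _) (by simp),
      Finset.sum_eq_single l (fun j _ hj => Set.indicator_of_notMem (hne j hj) _) (by simp),
      Set.indicator_of_mem hl, Set.indicator_of_mem hl]
  · push Not at hτ
    rw [value, Finset.sum_eq_zero fun l _ => Set.indicator_of_notMem (hτ l) _,
      Finset.sum_eq_zero fun l _ => Set.indicator_of_notMem (hτ l) _]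
    simp [weight, normSq]

/-- Clamping `p` and `q` to `[a, t]` leaves an interval with the length of `(p, q] ∩ (a, t]`,
including length zero when the two are disjoint. -/
theorem intervalIntegral_indicator_Ioc_const {a t p q : ℝ} (hat : a ≤ t) (hpq : p ≤ q) (c : ℝ) :
    ∫ τ in a..t, Set.indicator (Set.Ioc p q) (fun _ => c) τ =
      (max a (min q t) - max a (min p t)) * c := by
  rw [intervalIntegral.integral_of_le hat, setIntegral_indicator measurableSet_Ioc,
    Set.Ioc_inter_Ioc, setIntegral_const, Real.volume_real_Ioc, smul_eq_mul]
  congr 1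
  simp only [max_def, min_def]
  split_ifs <;> linarith

/-- The trace integral in terms of the partition of `[a, t]`. -/
theorem traceIntegral_eq_sum {V : CDOp r n n} (hV : ∀ k l, V (e k) l ∈ CDC.realForm r)
    (hat : a ≤ t) (ω : Ω) :
    S.traceIntegral V a t ω = (∑ l ∈ Finset.range S.k,
      ((S.clampedPt a t (l + 1) : ℝ) - S.clampedPt a t l) * weight V (S.coefNat l ω)) •
        (1 : CDC r) := by
  simp only [traceIntegral, tr_prod_adj hV (S.value_mem _ ω), weight_value]
  rw [intervalIntegral.integral_smul_const, intervalIntegral.integral_finsetSum, Finset.sum_range]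
  · congr 1
    refine Finset.sum_congr rfl fun l _ => ?_
    rw [intervalIntegral_indicator_Ioc_const hat
      (S.pt_strictMono.monotone l.castSucc_le_succ), S.coefNat_of_fin, S.clampedPt_of_fin,
      S.clampedPt_succ_of_fin]
    congr 2
  · intro l _
    rw [intervalIntegrable_iff]
    exact (integrable_indicator_iff measurableSet_Ioc).2 (by simp) |>.integrableOn

end ElementaryProcess

/-! ### The main theorem -/

open CDOp in
theorem theorem2p14 {Ω : Type*} [mΩ : MeasurableSpace Ω] (P : Measure Ω) [IsProbabilityMeasure P]
    (r n h : ℕ) (hr : 2 ≤ r)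
    (T : Set ℝ) (hT : (∃ s : ℝ, 0 < s ∧ T = Set.Icc 0 s) ∨ T = Set.Ici 0)
    (F : Filtration T mΩ)
    (U V : CDOp r n n) (hU : U ∈ CDOp.Lri r n n) (hV : CDOp.IsSqrt U V)
    (w : T → Ω → (Fin n → CDC r)) (hw : IsURandom P F V w)
    (S : ElementaryProcess F r n h) (a t : T) (hat : a < t) :
    -- both random variables are real and non-negative
    (∀ᵐ ω ∂P, ∃ x : ℝ, 0 ≤ x ∧
      CDOp.form (S.integral w a t ω) (S.integral w a t ω) = x • (1 : CDC r)) ∧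
    (∀ ω, ∃ x : ℝ, 0 ≤ x ∧ S.traceIntegral V a t ω = x • (1 : CDC r)) ∧
    -- the equality of the conditional expectations with values in `[0, ∞]`
    condLExp (F a) P
        (fun ω => ENNReal.ofReal (CDOp.form (S.integral w a t ω) (S.integral w a t ω)).re) =ᵐ[P]
      condLExp (F a) P (fun ω => ENNReal.ofReal (S.traceIntegral V a t ω).re) ∧
    -- the same for integrable random variables with values in the algebra
    (Integrable (fun ω => CDOp.form (S.integral w a t ω) (S.integral w a t ω)) P ↔
      Integrable (fun ω => S.traceIntegral V a t ω) P) ∧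
    P[fun ω => CDOp.form (S.integral w a t ω) (S.integral w a t ω) | F a] =ᵐ[P]
      P[fun ω => S.traceIntegral V a t ω | F a] ∧
    -- the same with `∫_0^t S dw` as the second argument, if the expectations exist
    (Integrable (fun ω => S.traceIntegral V a t ω) P →
      Integrable (fun ω => CDOp.form (S.integral w a t ω) (S.integralTo w t ω)) P →
      P[fun ω => CDOp.form (S.integral w a t ω) (S.integralTo w t ω) | F a] =ᵐ[P]
        P[fun ω => S.traceIntegral V a t ω | F a]) := by
  have hVr := hV.apply_e_mem_realForm
  have ha : 0 ≤ (a : ℝ) := by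
    have := a.2
    rcases hT with ⟨s, -, rfl⟩ | rfl
    · exact this.1
    · exact this
  have hα := S.monotone_clampedPt (a := a) (t := t)
  have hα0 : S.clampedPt a t 0 = a := S.clampedPt_zero ha
  have hS := fun m hlt => S.measurable_coefNat (a := a) (t := t) m hlt hat.le
  set Q : Ω → ℝ := fun ω => ∑ l ∈ Finset.range S.k,
    ((S.clampedPt a t (l + 1) : ℝ) - S.clampedPt a t l) * weight V (S.coefNat l ω)
  have htrace : S.traceIntegral V a t = fun ω => Q ω • (1 : CDC r) :=
    funext fun ω => S.traceIntegral_eq_sum hVr hat.le ω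
  have hint : S.integral w a t = fun ω => ∑ l ∈ Finset.range S.k, S.coefNat l ω
      (w (S.clampedPt a t (l + 1)) ω - w (S.clampedPt a t l) ω) :=
    funext fun ω => S.integral_eq_sum w hat.le ω
  have hQ0 : ∀ ω, 0 ≤ Q ω := fun ω =>
    Finset.sum_nonneg fun l _ => IsURandom.weight_term_nonneg hα l ω
  have hQm : Measurable Q :=
    Finset.measurable_fun_sum _ fun l _ => IsURandom.measurable_weight_term hα hS l
  have hIm : Measurable (S.integral w a t) := by
    rw [hint]
    exact (hw.measurable_sum_term hα hS S.k).mono (F.le _) le_rfl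
  have hreal : ∀ᵐ ω ∂P, form (S.integral w a t ω) (S.integral w a t ω) =
      normSq (S.integral w a t ω) • (1 : CDC r) := by
    -- `w` takes values in `A_r^n` only almost surely at each fixed time; countably many partition
    -- points share one null set.
    filter_upwards [ae_all_iff.2 fun m => hw.ae_realForm hVr (S.clampedPt a t m)] with ω hω
    refine form_self fun l => ?_
    simp only [hint, Finset.sum_apply]
    exact (CDC.realSub r).sum_mem fun m _ => (S.coefNat_mem m ω).2 _
      (fun k => (CDC.realSub r).sub_mem (hω (m + 1) k) (hω m k)) l
  have hset : ∀ A, MeasurableSet[F a] A →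
      ∫⁻ ω in A, ENNReal.ofReal (normSq (S.integral w a t ω)) ∂P =
        ∫⁻ ω in A, ENNReal.ofReal (Q ω) ∂P := by
    intro A hA
    rw [← hα0] at hA
    simp only [hint]
    exact hw.setLIntegral_normSq_sum hα hS hA S.k
  have h1 : (1 : CDC r) ≠ 0 := norm_ne_zero_iff.1 (by rw [CDC.norm_one]; exact one_ne_zero)
  obtain ⟨hiff, hcond⟩ := condExp_smul_ae_eq_of_setLIntegral_eq (P := P) h1 (F.le a)
    (measurable_normSq.comp hIm) hQm (fun ω => normSq_nonneg _) hQ0 hset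
  simp only [Function.comp_def] at hiff hcond
  have hiff' : Integrable (fun ω => form (S.integral w a t ω) (S.integral w a t ω)) P ↔
      Integrable (fun ω => S.traceIntegral V a t ω) P := by
    rw [integrable_congr hreal, hiff, htrace]
  have hcond' : P[fun ω => form (S.integral w a t ω) (S.integral w a t ω) | F a] =ᵐ[P]
      P[fun ω => S.traceIntegral V a t ω | F a] := by
    rw [htrace]
    exact (condExp_congr_ae hreal).trans hcond
  refine ⟨?_, ?_, ?_, hiff', hcond', ?_⟩
  · filter_upwards [hreal] with ω hω using ⟨_, normSq_nonneg _, hω⟩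
  · exact fun ω => ⟨Q ω, hQ0 ω, congrFun htrace ω⟩
  · have hl : (fun ω => ENNReal.ofReal (form (S.integral w a t ω) (S.integral w a t ω)).re) =ᵐ[P]
        fun ω => ENNReal.ofReal (normSq (S.integral w a t ω)) := by
      filter_upwards [hreal] with ω hω
      rw [hω, CDC.re_real_smul_one]
    refine (condLExp_congr_ae hl).trans ?_
    simp only [htrace, CDC.re_real_smul_one]
    exact condLExp_ae_eq_of_setLIntegral_eq (F.le a) hset
  · intro hti hci
    have hii := hiff'.2 hti
    have hQi : Integrable Q P := by
      rw [htrace] at hti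
      exact (integrable_smul_const h1).1 hti
    obtain ⟨hI, hI0⟩ := hw.condExp_sum_eq_zero hα hS S.k hQi
    rw [← hint] at hI
    rw [← hint, hα0] at hI0
    have hsplit : ∀ ω, form (S.integral w a t ω) (S.integralTo w t ω) =
        form (S.integral w a t ω) (S.integral w a t ω) +
          formL r h (S.integral w a t ω) (S.integralTo w a ω) := by
      intro ω
      simp only [← formL_apply]
      rw [← map_add]
      simp [ElementaryProcess.integral]
    -- No integrability of `∫_0^a S dw` is available, so that of the cross term is obtained as a
    -- difference of two integrable forms.
    have hz : Integrable
        (fun ω => formL r h (S.integral w a t ω) (S.integralTo w a ω)) P := by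
      refine (hci.sub hii).congr (ae_of_all _ fun ω => ?_)
      simp [hsplit]
    have hz0 := condExp_bilin_of_stronglyMeasurable_right (m := F a) (formL r h)
      (S.measurable_integralTo hw a).stronglyMeasurable hz hI
    simp only [hsplit]
    refine (condExp_add hii hz (F a)).trans ?_
    filter_upwards [hcond', hz0, hI0] with ω h2 h3 h4
    rw [Pi.add_apply, h2, h3, h4]
    simp

end
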